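/- Let $\pi(z_1,z_2)=(z_1+z_2,z_1z_2)$, let $\mathbb D=\{|z|<1\}$, $\mathbb T=\{|z|=1\}$, $\mathbb E=\{|z|>1\}$ in $\mathbb C$, and put $\mathbb G_2=\pi(\mathbb D^2)$ (the symmetrized bidisc), $\Gamma=\overline{\mathbb G_2}$ and $b\Gamma=\pi(\mathbb T^2)$ (the distinguished boundary of $\Gamma$). A $\Gamma$-unitary on a complex Hilbert space is a commuting pair of bounded normal operators whose Taylor joint spectrum is contained in $b\Gamma$. A polynomial $q\in\mathbb C[z_1,z_2]$ with zero set $Z(q)\subseteq\mathbb C^2$ is called distinguished if $Z(q)\subseteq\mathbb G_2\cup b\Gamma\cup\pi(\mathbb E^2)$. A closed subspace is joint reducing for a pair of operators if it and its orthogonal complement are invariant under both operators. Theorem. Let $\Sigma=(T,U)$ be a $\Gamma$-unitary acting on a complex Hilbert space $\mathcal K$, let $q\in\mathbb C[z_1,z_2]$ be a distinguished polynomial with $q(T,U)=0$, and let $q_1,\dots,q_N$ be the distinct irreducible factors of $q$ (listed once each, factors that differ by a nonzero constant being identified). Then there are closed joint reducing subspaces $\mathcal K_1,\dots,\mathcal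 K_N$ of $\mathcal K$ (some of which may be zero) such that $\mathcal K=\mathcal K_1\oplus\dots\oplus\mathcal K_N$ is an orthogonal decomposition and, for each $j$, the restriction $\Sigma|_{\mathcal K_j}=(T|_{\mathcal K_j},U|_{\mathcal K_j})$ is a $\Gamma$-unitary on $\mathcal K_j$ with $q_j(T|_{\mathcal K_j},U|_{\mathcal K_j})=0$. -/

import Mathlib

namespace GammaDecomp

/-- The symmetrization map `π(z₁, z₂) = (z₁ + z₂, z₁ z₂)`. -/
def symmetrization (z : ℂ × ℂ) : ℂ × ℂ := (z.1 + z.2, z.1 * z.2)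

/-- The symmetrized bidisc `𝔾₂ = π(𝔻²)`. -/
def G2 : Set (ℂ × ℂ) := symmetrization '' {z | ‖z.1‖ < 1 ∧ ‖z.2‖ < 1}

/-- The distinguished boundary `bΓ = π(𝕋²)` of `Γ`, the closure of `𝔾₂`. -/
def bGamma : Set (ℂ × ℂ) := symmetrization '' {z | ‖z.1‖ = 1 ∧ ‖z.2‖ = 1}

/-- The set `π(𝔼²)`, where `𝔼` is the complement of the closed unit disc. -/
def piE2 : Set (ℂ × ℂ) := symmetrization '' {z | 1 < ‖z.1‖ ∧ 1 < ‖z.2‖}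

/-- The zero set `Z(q)` in `ℂ²` of a polynomial in two variables. -/
def zeroSet (q : MvPolynomial (Fin 2) ℂ) : Set (ℂ × ℂ) :=
  {z | MvPolynomial.eval ![z.1, z.2] q = 0}

/-- A polynomial is distinguished if `Z(q) ⊆ 𝔾₂ ∪ bΓ ∪ π(𝔼²)`. -/
def IsDistinguished (q : MvPolynomial (Fin 2) ℂ) : Prop :=
  zeroSet q ⊆ G2 ∪ bGamma ∪ piE2

/-- `q₁, …, q_N` is a complete list, without repetition, of the irreducible factors of `q`,
where factors are identified when they differ by a nonzero constant. -/
structure IsDistinctIrreducibleFactors (q : MvPolynomial (Fin 2) ℂ) {N : ℕ}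
    (f : Fin N → MvPolynomial (Fin 2) ℂ) : Prop where
  irreducible : ∀ j, Irreducible (f j)
  dvd : ∀ j, f j ∣ q
  distinct : ∀ i j, i ≠ j → ¬ Associated (f i) (f j)
  complete : ∀ p, Irreducible p → p ∣ q → ∃ j, Associated p (f j)

section Operators

variable {H : Type*} [NormedAddCommGroup H] [InnerProductSpace ℂ H]

/-- The operator `q(T, U)`, for a commuting pair `(T, U)`. -/
noncomputable def polyEval (q : MvPolynomial (Fin 2) ℂ) (T U : H →L[ℂ] H) : H →L[ℂ] H :=
  ∑ m ∈ q.support, q.coeff m • (T ^ m 0 * U ^ m 1)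

/-- The first map `x ↦ (A x, B x)` of the Koszul complex `0 → H → H ⊕ H → H → 0` of `(A, B)`. -/
def koszulFst (A B : H →L[ℂ] H) : H →L[ℂ] H × H := A.prod B

/-- The second map `(x, y) ↦ A y - B x` of the Koszul complex of `(A, B)`. -/
def koszulSnd (A B : H →L[ℂ] H) : H × H →L[ℂ] H :=
  A.comp (ContinuousLinearMap.snd ℂ H H) - B.comp (ContinuousLinearMap.fst ℂ H H)

/-- Exactness of the Koszul complex `0 → H → H ⊕ H → H → 0` of a commuting pair `(A, B)`. -/
def KoszulExact (A B : H →L[ℂ] H) : Prop :=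
  Function.Injective (koszulFst A B) ∧
    Function.Exact (koszulFst A B) (koszulSnd A B) ∧
    Function.Surjective (koszulSnd A B)

/-- The Taylor joint spectrum of a commuting pair `(T, U)`: the points `(z₁, z₂)` at which the
Koszul complex of `(T - z₁, U - z₂)` is not exact. -/
def taylorSpectrum (T U : H →L[ℂ] H) : Set (ℂ × ℂ) :=
  {z | ¬ KoszulExact (T - z.1 • (1 : H →L[ℂ] H)) (U - z.2 • (1 : H →L[ℂ] H))}

/-- A `Γ`-unitary: a commuting pair of normal operators on a Hilbert space whose Taylor joint
spectrum is contained in `bΓ`. -/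
structure IsGammaUnitary [CompleteSpace H] (T U : H →L[ℂ] H) : Prop where
  commute : Commute T U
  normal_fst : IsStarNormal T
  normal_snd : IsStarNormal U
  spectrum_subset : taylorSpectrum T U ⊆ bGamma

/-- A closed subspace `V` such that `V` and its orthogonal complement are invariant under both
`T` and `U`. -/
structure IsJointReducing (T U : H →L[ℂ] H) (V : Submodule ℂ H) : Prop where
  closed : IsClosed (V : Set H)
  map_fst : ∀ x ∈ V, T x ∈ V
  map_snd : ∀ x ∈ V, U x ∈ V
  map_fst_orthogonal : ∀ x ∈ Vᗮ, T x ∈ Vᗮ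
  map_snd_orthogonal : ∀ x ∈ Vᗮ, U x ∈ Vᗮ

/-- The subspaces `K₁, …, K_N` are pairwise orthogonal and their sum is the whole space. -/
def IsOrthogonalDecomposition {N : ℕ} (K : Fin N → Submodule ℂ H) : Prop :=
  (∀ i j, i ≠ j → K i ⟂ K j) ∧ (⨆ j, K j) = ⊤

/-- The closed joint reducing subspace `V` is such that the restrictions of `T` and `U` to `V`
form a `Γ`-unitary, on the Hilbert space `V`, annihilated by `p`. -/
def RestrictsToGammaUnitary [CompleteSpace H] (T U : H →L[ℂ] H) (V : Submodule ℂ H)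
    (hV : IsJointReducing T U V) (p : MvPolynomial (Fin 2) ℂ) : Prop :=
  haveI : CompleteSpace V := hV.closed.completeSpace_coe
  IsGammaUnitary (T.restrict hV.map_fst) (U.restrict hV.map_snd) ∧
    polyEval p (T.restrict hV.map_fst) (U.restrict hV.map_snd) = 0

end Operators

end GammaDecomp

namespace GammaDecomp

/-! ### Polynomial calculus and restriction to joint reducing subspaces. -/

section Operators

variable {H : Type*} [NormedAddCommGroup H] [InnerProductSpace ℂ H]

/-! By Fuglede's theorem `T` and `U` commute with each other's adjoints, so the kernels of the
`q_j(T, U)` are joint reducing. They may overlap, so they are made orthogonal by exhaustion: each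
summand is the part of the next kernel lying in the orthogonal complement of the summands already
chosen (`remainder`). On what is left at the end every `q_j(T, U)` is injective, hence so is `q(T,
U)`, whatever the multiplicities, by `polyEval_injective_of_irreducible`. Since `q(T, U) = 0`,
nothing is left. Restrictions stay `Γ`-unitary because the Koszul complex splits along a reducing
subspace, so the Taylor spectrum can only shrink. Distinguishedness enters through `q ≠ 0`. -/

lemma exists_algHom_eq_polyEval {T U : H →L[ℂ] H} (h : Commute T U) :
    ∃ φ : MvPolynomial (Fin 2) ℂ →ₐ[ℂ] (H →L[ℂ] H), ∀ q, φ q = polyEval q T U := by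
  let g : Multiplicative (Fin 2 →₀ ℕ) →* (H →L[ℂ] H) :=
    { toFun := fun m => T ^ m.toAdd 0 * U ^ m.toAdd 1
      map_one' := by simp
      map_mul' := fun m n => by
        have := (h.pow_pow (n.toAdd 0) (m.toAdd 1)).eq
        simp only [toAdd_mul, Finsupp.add_apply, pow_add]
        rw [mul_assoc, mul_assoc, ← mul_assoc (T ^ n.toAdd 0), this]
        simp only [mul_assoc] }
  exact ⟨AddMonoidAlgebra.lift ℂ _ _ g, fun q => AddMonoidAlgebra.lift_apply g q⟩

lemma polyEval_mul {T U : H →L[ℂ] H} (h : Commute T U) (p q : MvPolynomial (Fin 2) ℂ) :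
    polyEval (p * q) T U = polyEval p T U * polyEval q T U := by
  obtain ⟨φ, hφ⟩ := exists_algHom_eq_polyEval h
  simp only [← hφ, map_mul]

lemma polyEval_one {T U : H →L[ℂ] H} (h : Commute T U) : polyEval 1 T U = 1 := by
  obtain ⟨φ, hφ⟩ := exists_algHom_eq_polyEval h
  simp only [← hφ, map_one]

lemma Commute.polyEval_right {S T U : H →L[ℂ] H} (hT : Commute S T) (hU : Commute S U)
    (q : MvPolynomial (Fin 2) ℂ) : Commute S (polyEval q T U) :=
  Commute.sum_right _ _ _ fun m _ =>
    ((hT.pow_right (m 0)).mul_right (hU.pow_right (m 1))).smul_right _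

lemma coe_restrict_pow_apply {T : H →L[ℂ] H} {V : Submodule ℂ H} (hT : ∀ x ∈ V, T x ∈ V)
    (n : ℕ) (x : V) : ((T.restrict hT ^ n) x : H) = (T ^ n) x := by
  induction n generalizing x with
  | zero => simp
  | succ n ih =>
    rw [pow_succ, pow_succ, mul_apply_eq_comp, mul_apply_eq_comp, ih,
      ContinuousLinearMap.coe_restrict_apply]

lemma coe_polyEval_restrict_apply {T U : H →L[ℂ] H} {V : Submodule ℂ H}
    (hT : ∀ x ∈ V, T x ∈ V) (hU : ∀ x ∈ V, U x ∈ V) (q : MvPolynomial (Fin 2) ℂ) (x : V) :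
    (polyEval q (T.restrict hT) (U.restrict hU) x : H) = polyEval q T U x := by
  simp only [polyEval, sum_apply, smul_apply, mul_apply_eq_comp, Submodule.coe_sum,
    Submodule.coe_smul, coe_restrict_pow_apply]

/-- The Koszul complex of a pair of operators restricted to a complemented invariant subspace with
invariant complement is a direct summand of the Koszul complex of the pair. -/
lemma KoszulExact.restrict {A B : H →L[ℂ] H} (h : KoszulExact A B) {V W : Submodule ℂ H}
    (hVW : IsCompl V W) (hA : ∀ x ∈ V, A x ∈ V) (hB : ∀ x ∈ V, B x ∈ V)
    (hA' : ∀ x ∈ W, A x ∈ W) (hB' : ∀ x ∈ W, B x ∈ W) :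
    KoszulExact (A.restrict hA) (B.restrict hB) := by
  obtain ⟨h₁, h₂, h₃⟩ := h
  -- Uniqueness of `V`-components: identities in `H` whose right side lies in `V` may be projected
  -- to `V`.
  have key : ∀ {v w v' : H}, v ∈ V → w ∈ W → v' ∈ V → v + w = v' → v = v' := by
    intro v w v' hv hw hv' e
    have hw' : w ∈ V := by
      have : w = v' - v := by rw [← e]; abel
      exact this ▸ V.sub_mem hv' hv
    have : w = 0 := Submodule.disjoint_def.1 hVW.disjoint w hw' hw
    simpa [this] using e
  have split : ∀ x : H, ∃ v ∈ V, ∃ w ∈ W, v + w = x := fun x =>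
    Submodule.mem_sup.1 (hVW.sup_eq_top ▸ Submodule.mem_top)
  refine ⟨fun x y hxy => ?_, fun ⟨x, y⟩ => ⟨fun hxy => ?_, ?_⟩, fun z => ?_⟩
  · have e₁ : A x = A y := congrArg (fun z => ((z.1 : V) : H)) hxy
    have e₂ : B x = B y := congrArg (fun z => ((z.2 : V) : H)) hxy
    exact Subtype.ext (h₁ (Prod.ext e₁ e₂))
  · have e : koszulSnd A B (x, y) = 0 := congrArg (fun z : V => (z : H)) hxy
    obtain ⟨z, hz⟩ := (h₂ _).1 e
    obtain ⟨v, hv, w, hw, rfl⟩ := split z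
    have e₁ : A (v + w) = x := congrArg Prod.fst hz
    have e₂ : B (v + w) = y := congrArg Prod.snd hz
    rw [map_add] at e₁ e₂
    exact ⟨⟨v, hv⟩, Prod.ext (Subtype.ext (key (hA v hv) (hA' w hw) x.2 e₁))
      (Subtype.ext (key (hB v hv) (hB' w hw) y.2 e₂))⟩
  · rintro ⟨v, hv⟩
    have e : koszulSnd A B (koszulFst A B v) = 0 := (h₂ _).2 ⟨_, rfl⟩
    rw [← hv]
    exact Subtype.ext e
  · obtain ⟨⟨a, b⟩, hab⟩ := h₃ z
    obtain ⟨v, hv, w, hw, rfl⟩ := split a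
    obtain ⟨v', hv', w', hw', rfl⟩ := split b
    have e : A (v' + w') - B (v + w) = z := hab
    refine ⟨(⟨v, hv⟩, ⟨v', hv'⟩), Subtype.ext ?_⟩
    refine key (V.sub_mem (hA v' hv') (hB v hv)) (W.sub_mem (hA' w' hw') (hB' w hw)) z.2 ?_
    rw [← e, map_add, map_add]
    exact (add_sub_add_comm _ _ _ _).symm

lemma taylorSpectrum_restrict_subset {T U : H →L[ℂ] H} {V W : Submodule ℂ H}
    (hVW : IsCompl V W) (hT : ∀ x ∈ V, T x ∈ V) (hU : ∀ x ∈ V, U x ∈ V)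
    (hT' : ∀ x ∈ W, T x ∈ W) (hU' : ∀ x ∈ W, U x ∈ W) :
    taylorSpectrum (T.restrict hT) (U.restrict hU) ⊆ taylorSpectrum T U := by
  intro z hz h
  have shift : ∀ {S : H →L[ℂ] H} (c : ℂ) {Y : Submodule ℂ H}, (∀ x ∈ Y, S x ∈ Y) →
      ∀ x ∈ Y, (S - c • (1 : H →L[ℂ] H)) x ∈ Y := fun c Y hS x hx =>
    Y.sub_mem (hS x hx) (Y.smul_mem c hx)
  exact hz (h.restrict hVW (shift z.1 hT) (shift z.2 hU) (shift z.1 hT') (shift z.2 hU'))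

lemma map_mem_orthogonal [CompleteSpace H] {S : H →L[ℂ] H} {V : Submodule ℂ H}
    (h : ∀ x ∈ V, star S x ∈ V) : ∀ x ∈ Vᗮ, S x ∈ Vᗮ := by
  intro x hx
  rw [Submodule.mem_orthogonal] at hx ⊢
  intro u hu
  rw [← ContinuousLinearMap.adjoint_inner_left]
  exact hx _ (h u hu)

lemma map_adjoint_mem [CompleteSpace H] {S : H →L[ℂ] H} {V : Submodule ℂ H}
    (hV : IsClosed (V : Set H)) (h : ∀ x ∈ Vᗮ, S x ∈ Vᗮ) : ∀ x ∈ V, star S x ∈ V := by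
  have : CompleteSpace V := hV.completeSpace_coe
  intro x hx
  rw [← Submodule.orthogonal_orthogonal V] at hx ⊢
  exact map_mem_orthogonal (by simpa using h) x hx

/-- Invariance under `star S` makes the adjoint of the restriction the restriction of the adjoint.
-/
lemma isStarNormal_restrict [CompleteSpace H] {S : H →L[ℂ] H} (hS : IsStarNormal S)
    {V : Submodule ℂ H} [CompleteSpace V] (h : ∀ x ∈ V, S x ∈ V) (h' : ∀ x ∈ V, star S x ∈ V) :
    IsStarNormal (S.restrict h) := by
  have e : star (S.restrict h) = (star S).restrict h' := by
    refine Eq.symm ((ContinuousLinearMap.eq_adjoint_iff _ _).2 fun x y => ?_)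
    exact ContinuousLinearMap.adjoint_inner_left S (y : H) (x : H)
  refine ⟨?_⟩
  rw [e]
  ext x
  exact congrArg (fun R : H →L[ℂ] H => R x) hS.star_comm_self.eq

namespace IsJointReducing

variable {T U : H →L[ℂ] H} {V W : Submodule ℂ H}

lemma top : IsJointReducing T U ⊤ where
  closed := isClosed_univ
  map_fst _ _ := trivial
  map_snd _ _ := trivial
  map_fst_orthogonal x hx := by simp_all
  map_snd_orthogonal x hx := by simp_all

lemma of_star [CompleteSpace H] (hV : IsClosed (V : Set H))
    (hT : ∀ x ∈ V, T x ∈ V) (hU : ∀ x ∈ V, U x ∈ V)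
    (hT' : ∀ x ∈ V, star T x ∈ V) (hU' : ∀ x ∈ V, star U x ∈ V) : IsJointReducing T U V :=
  ⟨hV, hT, hU, map_mem_orthogonal hT', map_mem_orthogonal hU'⟩

lemma inf [CompleteSpace H] (hV : IsJointReducing T U V) (hW : IsJointReducing T U W) :
    IsJointReducing T U (V ⊓ W) :=
  of_star (hV.closed.inter hW.closed)
    (fun x hx => ⟨hV.map_fst x hx.1, hW.map_fst x hx.2⟩)
    (fun x hx => ⟨hV.map_snd x hx.1, hW.map_snd x hx.2⟩)
    (fun x hx => ⟨map_adjoint_mem hV.closed hV.map_fst_orthogonal x hx.1,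
      map_adjoint_mem hW.closed hW.map_fst_orthogonal x hx.2⟩)
    (fun x hx => ⟨map_adjoint_mem hV.closed hV.map_snd_orthogonal x hx.1,
      map_adjoint_mem hW.closed hW.map_snd_orthogonal x hx.2⟩)

lemma orthogonal [CompleteSpace H] (hV : IsJointReducing T U V) : IsJointReducing T U Vᗮ := by
  have : CompleteSpace V := hV.closed.completeSpace_coe
  refine ⟨V.isClosed_orthogonal, hV.map_fst_orthogonal, hV.map_snd_orthogonal, ?_, ?_⟩ <;>
    rw [Submodule.orthogonal_orthogonal]
  exacts [hV.map_fst, hV.map_snd]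

lemma polyEval_mem (hV : IsJointReducing T U V) (q : MvPolynomial (Fin 2) ℂ) {x : H}
    (hx : x ∈ V) : polyEval q T U x ∈ V := by
  rw [← coe_polyEval_restrict_apply hV.map_fst hV.map_snd q ⟨x, hx⟩]
  exact Subtype.coe_prop _

end IsJointReducing

variable [CompleteSpace H] {T U : H →L[ℂ] H}

lemma IsGammaUnitary.restrict (h : IsGammaUnitary T U) {V : Submodule ℂ H} [CompleteSpace V]
    (hV : IsJointReducing T U V) :
    IsGammaUnitary (T.restrict hV.map_fst) (U.restrict hV.map_snd) where
  commute := by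
    ext x
    exact congrArg (fun R : H →L[ℂ] H => R x) h.commute.eq
  normal_fst := isStarNormal_restrict h.normal_fst _
    (map_adjoint_mem hV.closed hV.map_fst_orthogonal)
  normal_snd := isStarNormal_restrict h.normal_snd _
    (map_adjoint_mem hV.closed hV.map_snd_orthogonal)
  spectrum_subset := (taylorSpectrum_restrict_subset V.isCompl_orthogonal
    _ _ hV.map_fst_orthogonal hV.map_snd_orthogonal).trans h.spectrum_subset

/-- By Fuglede's theorem the kernel of a polynomial in a commuting pair of normal operators
reduces the pair. -/
lemma IsGammaUnitary.isJointReducing_ker (h : IsGammaUnitary T U)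
    (q : MvPolynomial (Fin 2) ℂ) : IsJointReducing T U (polyEval q T U).ker := by
  have mem : ∀ {S : H →L[ℂ] H}, Commute S T → Commute S U →
      ∀ x ∈ (polyEval q T U).ker, S x ∈ (polyEval q T U).ker := by
    intro S hT hU x hx
    have hx' : polyEval q T U x = 0 := hx
    have e : S (polyEval q T U x) = polyEval q T U (S x) :=
      congrArg (fun R : H →L[ℂ] H => R x) (Commute.polyEval_right hT hU q).eq
    change polyEval q T U (S x) = 0
    rw [← e, hx', map_zero]
  exact .of_star (polyEval q T U).isClosed_ker (mem (.refl T) h.commute)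
    (mem h.commute.symm (.refl U))
    (mem h.normal_fst.star_comm_self (h.normal_fst.commute_star_left h.commute))
    (mem (h.normal_snd.commute_star_left h.commute.symm) h.normal_snd.star_comm_self)

end Operators

/-! ### Orthogonal exhaustion by a sequence of subspaces. -/

section Exhaustion

variable {H : Type*} [NormedAddCommGroup H] [InnerProductSpace ℂ H]

/-- The successive orthogonal remainders `Rₙ₊₁ = Rₙ ⊖ (Vₙ ∩ Rₙ)`, starting from `R₀ = H`. -/
noncomputable def remainder (V : ℕ → Submodule ℂ H) : ℕ → Submodule ℂ H
  | 0 => ⊤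
  | n + 1 => (V n ⊓ remainder V n)ᗮ ⊓ remainder V n

variable {V : ℕ → Submodule ℂ H}

lemma remainder_antitone : Antitone (remainder V) :=
  antitone_nat_of_succ_le fun _ => inf_le_right

lemma isOrtho_inf_remainder {i j : ℕ} (h : i < j) :
    (V i ⊓ remainder V i) ⟂ (V j ⊓ remainder V j) :=
  Submodule.IsOrtho.symm
    (inf_le_right.trans ((remainder_antitone (Nat.succ_le_of_lt h)).trans inf_le_left))

/-- The intersection lies both in `V i ⊓ remainder V i` and, as `remainder V n ≤ remainder V (i +
1)`, in its orthogonal complement. -/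
lemma inf_remainder_eq_bot {i n : ℕ} (h : i < n) : V i ⊓ remainder V n = ⊥ := by
  rw [eq_bot_iff, ← Submodule.inf_orthogonal_eq_bot (V i ⊓ remainder V i)]
  exact le_inf (inf_le_inf_left _ (remainder_antitone h.le))
    (inf_le_right.trans ((remainder_antitone (Nat.succ_le_of_lt h)).trans inf_le_left))

lemma isJointReducing_remainder [CompleteSpace H] {T U : H →L[ℂ] H}
    (hV : ∀ n, IsJointReducing T U (V n)) (n : ℕ) : IsJointReducing T U (remainder V n) := by
  induction n with
  | zero => exact .top
  | succ n ih => exact ((hV n).inf ih).orthogonal.inf ih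

lemma iSup_inf_remainder_sup [CompleteSpace H] {T U : H →L[ℂ] H}
    (hV : ∀ n, IsJointReducing T U (V n)) (N n : ℕ) (hn : n ≤ N) :
    (⨆ j : Fin N, V j ⊓ remainder V j) ⊔ remainder V n = ⊤ := by
  induction n with
  | zero => simp [remainder]
  | succ n ih =>
    have : CompleteSpace ↥(V n ⊓ remainder V n) :=
      ((hV n).inf (isJointReducing_remainder hV n)).closed.completeSpace_coe
    rw [eq_top_iff, ← ih (by omega)]
    refine sup_le le_sup_left ?_
    -- The old remainder is the `n`-th summand plus the new remainder.
    rw [← Submodule.sup_orthogonal_inf_of_hasOrthogonalProjection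
      (inf_le_right : V n ⊓ remainder V n ≤ remainder V n)]
    exact sup_le_sup_right (le_iSup (fun j : Fin N => V j ⊓ remainder V j) ⟨n, hn⟩) _

end Exhaustion

/-- The point `π(2, 0) = (2, 0)` has one root inside the disc and one outside, so it avoids all
three allowed sets. -/
lemma IsDistinguished.ne_zero {q : MvPolynomial (Fin 2) ℂ} (hq : IsDistinguished q) : q ≠ 0 := by
  rintro rfl
  have roots : ∀ z : ℂ × ℂ, symmetrization z = (2, 0) → (z.1 = 0 ∧ ‖z.2‖ = 2) ∨
      (‖z.1‖ = 2 ∧ z.2 = 0) := by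
    rintro ⟨a, b⟩ h
    obtain ⟨h₁, h₂⟩ := Prod.ext_iff.1 h
    simp only [symmetrization] at h₁ h₂
    rcases mul_eq_zero.1 h₂ with rfl | rfl
    · rw [zero_add] at h₁
      simp [h₁]
    · rw [add_zero] at h₁
      simp [h₁]
  have h : ((2, 0) : ℂ × ℂ) ∈ zeroSet 0 := by simp [zeroSet]
  rcases hq h with (⟨z, hz, e⟩ | ⟨z, hz, e⟩) | ⟨z, hz, e⟩ <;>
    rcases roots z e with ⟨h₁, h₂⟩ | ⟨h₁, h₂⟩ <;>
    simp only [Set.mem_ofPred_eq, h₁, h₂, norm_zero] at hz <;> norm_num at hz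

/-! ### Injectivity of a product from its irreducible factors. -/

section Annihilation

variable {H : Type*} [NormedAddCommGroup H] [InnerProductSpace ℂ H] {T U : H →L[ℂ] H}

lemma polyEval_apply_eq_zero_of_dvd (h : Commute T U) {p r : MvPolynomial (Fin 2) ℂ}
    (hpr : p ∣ r) {x : H} (hx : polyEval p T U x = 0) : polyEval r T U x = 0 := by
  obtain ⟨s, rfl⟩ := hpr
  rw [mul_comm, polyEval_mul h, mul_apply_eq_comp, hx, map_zero]

/-- If all irreducible factors of `q ≠ 0` are injective on a joint reducing subspace, then so
is `q`. -/
lemma polyEval_injective_of_irreducible (h : Commute T U) {W : Submodule ℂ H}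
    (hW : IsJointReducing T U W) {q : MvPolynomial (Fin 2) ℂ} (hq : q ≠ 0)
    (hirr : ∀ p, Irreducible p → p ∣ q → ∀ x ∈ W, polyEval p T U x = 0 → x = 0) :
    ∀ x ∈ W, polyEval q T U x = 0 → x = 0 := by
  induction q using WfDvdMonoid.induction_on_irreducible with
  | zero => exact absurd rfl hq
  | unit u hu =>
    intro x _ hx
    have h₁ := polyEval_apply_eq_zero_of_dvd h (hu.dvd : u ∣ 1) hx
    rwa [polyEval_one h] at h₁
  | mul a i ha hi ih =>
    intro x hxW hx
    rw [polyEval_mul h, mul_apply_eq_comp] at hx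
    -- Invariance of `W` keeps `polyEval a T U x` in `W`, where injectivity for `i` applies.
    exact ih ha (fun p hp hpa => hirr p hp (hpa.mul_left i)) x hxW
      (hirr i hi (dvd_mul_right i a) _ (hW.polyEval_mem a hxW) hx)

end Annihilation

end GammaDecomp

theorem mainTheorem11 {H : Type*} [NormedAddCommGroup H] [InnerProductSpace ℂ H] [CompleteSpace H]
    (T U : H →L[ℂ] H) (hTU : GammaDecomp.IsGammaUnitary T U)
    (q : MvPolynomial (Fin 2) ℂ) (hq : GammaDecomp.IsDistinguished q)
    (hann : GammaDecomp.polyEval q T U = 0)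
    (N : ℕ) (f : Fin N → MvPolynomial (Fin 2) ℂ)
    (hf : GammaDecomp.IsDistinctIrreducibleFactors q f) :
    ∃ (K : Fin N → Submodule ℂ H) (hK : ∀ j, GammaDecomp.IsJointReducing T U (K j)),
      GammaDecomp.IsOrthogonalDecomposition K ∧
        ∀ j, GammaDecomp.RestrictsToGammaUnitary T U (K j) (hK j) (f j) := by
  open GammaDecomp in
  -- The padding value `1` is immaterial: only indices below `N` enter `remainder V N` and the
  -- summands.
  let g : ℕ → MvPolynomial (Fin 2) ℂ := fun n => if h : n < N then f ⟨n, h⟩ else 1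
  have hg : ∀ j : Fin N, g j = f j := fun j => by simp [g]
  let V : ℕ → Submodule ℂ H := fun n => (polyEval (g n) T U).ker
  have hV : ∀ n, IsJointReducing T U (V n) := fun n => hTU.isJointReducing_ker (g n)
  have hW : remainder V N = ⊥ := by
    refine (Submodule.eq_bot_iff _).2 fun x hx => ?_
    refine polyEval_injective_of_irreducible hTU.commute (isJointReducing_remainder hV N)
      hq.ne_zero (fun p hp hpq y hy hpy => ?_) x hx (by simp [hann])
    obtain ⟨j, hj⟩ := hf.complete p hp hpq
    have hyV : y ∈ V j := by
      change polyEval (g j) T U y = 0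
      rw [hg]
      exact polyEval_apply_eq_zero_of_dvd hTU.commute hj.dvd hpy
    have : y ∈ V j ⊓ remainder V N := ⟨hyV, hy⟩
    rwa [inf_remainder_eq_bot j.2, Submodule.mem_bot] at this
  refine ⟨fun j => V j ⊓ remainder V j, fun j => (hV j).inf (isJointReducing_remainder hV j),
    ⟨fun i j hij => ?_, ?_⟩, fun j => ?_⟩
  · rcases lt_or_gt_of_ne hij with h | h
    · exact isOrtho_inf_remainder h
    · exact (isOrtho_inf_remainder h).symm
  · simpa [hW] using iSup_inf_remainder_sup hV N N le_rfl
  · have hj := (hV j).inf (isJointReducing_remainder hV j)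
    have : CompleteSpace ↥(V j ⊓ remainder V j) := hj.closed.completeSpace_coe
    refine ⟨hTU.restrict hj, ?_⟩
    ext x
    rw [coe_polyEval_restrict_apply, ← hg]
    exact x.2.1
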